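/- Let $R$ be an associative ring with identity (not necessarily commutative). Suppose that: 1. $R$ is left and right mininjective, i.e. for every minimal left ideal $I$ of $R$, every homomorphism of left $R$-modules $I\to R$ extends to a homomorphism of left $R$-modules $R\to R$, and likewise for minimal right ideals and homomorphisms of right $R$-modules; 2. $R$ has the ascending chain condition on right annihilators, i.e. every ascending sequence of right ideals of the form $\mathbf r(X)=\{r\in R: xr=0\text{ for all }x\in X\}$ with $X\subseteq R$ is eventually constant; 3. the right socle $S_r$ of $R$ (the sum of all minimal right ideals) is essential in $R_R$, i.e. $S_r\cap K\neq 0$ for every nonzero right ideal $K$ of $R$. Then $R$ is quasi-Frobenius, i.e. $R$ is left and right artinian and left and right self-injective. -/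

import Mathlib

/-!
Rings are associative with identity and not necessarily commutative. The left module `_R R` is
`R` as an `R`-module; the right module `R_R` is `R` as an `Rᵐᵒᵖ`-module, so that right ideals are
the elements of `Submodule Rᵐᵒᵖ R` and homomorphisms of right modules are `Rᵐᵒᵖ`-linear maps.
-/

namespace QFRing

open MulOpposite

/-- `R` is left mininjective: every `R`-homomorphism from a minimal left ideal to `R` extends to an
`R`-homomorphism from `R` to `R`. (A left ideal is minimal iff it is simple as a module.) -/
def IsLeftMininjective (R : Type*) [Ring R] : Prop :=
  ∀ I : Submodule R R, IsSimpleModule R I →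
    ∀ f : I →ₗ[R] R, ∃ g : R →ₗ[R] R, ∀ x : I, g (x : R) = f x

/-- `R` is right mininjective: every homomorphism of right modules from a minimal right ideal to `R`
extends to a homomorphism of right modules from `R` to `R`. -/
def IsRightMininjective (R : Type*) [Ring R] : Prop :=
  ∀ I : Submodule Rᵐᵒᵖ R, IsSimpleModule Rᵐᵒᵖ I →
    ∀ f : I →ₗ[Rᵐᵒᵖ] R, ∃ g : R →ₗ[Rᵐᵒᵖ] R, ∀ x : I, g (x : R) = f x

/-- The right annihilator `{r | x * r = 0 for all x ∈ X}` of a subset `X`, as a right ideal. -/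
def rightAnnihilator {R : Type*} [Ring R] (X : Set R) : Submodule Rᵐᵒᵖ R where
  carrier := {r | ∀ x ∈ X, x * r = 0}
  zero_mem' := fun x _ => mul_zero x
  add_mem' := fun {a b} ha hb x hx => by rw [mul_add, ha x hx, hb x hx, add_zero]
  smul_mem' := fun c r hr x hx => by
    rw [← op_unop c, op_smul_eq_mul, ← mul_assoc, hr x hx, zero_mul]

/-- ACC on right annihilators: every ascending sequence of right annihilators of subsets of `R`
is eventually constant. -/
def ACCRightAnnihilators (R : Type*) [Ring R] : Prop :=
  ∀ X : ℕ → Set R, (∀ n, rightAnnihilator (X n) ≤ rightAnnihilator (X (n + 1))) →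
    ∃ n, ∀ m, n ≤ m → rightAnnihilator (X m) = rightAnnihilator (X n)

/-- The right socle of `R`: the sum of all minimal right ideals. -/
def rightSocle (R : Type*) [Ring R] : Submodule Rᵐᵒᵖ R :=
  sSup {I : Submodule Rᵐᵒᵖ R | IsSimpleModule Rᵐᵒᵖ I}

/-- A submodule `N` of `M` is essential: it meets every nonzero submodule of `M` nontrivially. -/
def IsEssential {A M : Type*} [Ring A] [AddCommGroup M] [Module A M] (N : Submodule A M) : Prop :=
  ∀ K : Submodule A M, K ≠ ⊥ → N ⊓ K ≠ ⊥

/-- `R` is quasi-Frobenius: left and right artinian, and left and right self-injective. -/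
structure IsQuasiFrobenius (R : Type*) [Ring R] : Prop where
  left_artinian : IsArtinian R R
  right_artinian : IsArtinian Rᵐᵒᵖ R
  left_self_injective : Module.Injective R R
  right_self_injective : Module.Injective Rᵐᵒᵖ R

end QFRing

/-! Mininjectivity on the side of `A` says that `Hom_A(-, R)` sends each simple module to zero or a
simple module over the other side, so this functor never increases length (`length_hom_le`). Applied
to the regular module on both sides, this makes the left and right lengths of `R` equal. If they are
finite, counting lengths forces every restriction `Hom(R, R) → Hom(I, R)` to be onto, which is
Baer's criterion (`baer_of_length_eq`).

Finite length comes from right mininjectivity, the chain condition and the essential socle. The left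
annihilator `Z` of the minimal right ideals is nilpotent and equals the Jacobson radical `J`, and `R
⧸ Z` is semisimple, so `R` is semiprimary. The left annihilator of `J` has finite length by duality;
the left annihilators of the powers of `J` are then artinian by induction, and the last one is `R`.
-/

namespace QFRing

open MulOpposite

/-! ### Duality and length -/

section Bimodule

variable {A B M : Type*} [Ring A] [Ring B] [AddCommGroup M] [Module A M] [Module B M]
  [SMulCommClass A B M]

/-- Every `A`-linear map from a simple submodule of `M` to `M` is given by the action of an element
of `B`. For `M = R`, with `A` and `B` acting from the two sides, this is mininjectivity. -/
def SimpleMapsAreScalars (A B M : Type*) [Ring A] [Ring B] [AddCommGroup M] [Module A M]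
    [Module B M] : Prop :=
  ∀ I : Submodule A M, IsSimpleModule A I → ∀ f : I →ₗ[A] M, ∃ b : B, ∀ x : I, b • (x : M) = f x

/-- Precomposition with an `A`-linear map, as a `B`-linear map. -/
def precomp (B M : Type*) [Ring B] [AddCommGroup M] [Module A M] [Module B M] [SMulCommClass A B M]
    {N N' : Type*} [AddCommGroup N] [Module A N] [AddCommGroup N'] [Module A N']
    (f : N →ₗ[A] N') : (N' →ₗ[A] M) →ₗ[B] (N →ₗ[A] M) where
  toFun g := g ∘ₗ f
  map_add' _ _ := rfl
  map_smul' _ _ := rfl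

theorem exists_smul_eq_of_isSimpleModule (h : SimpleMapsAreScalars A B M) {N : Type*}
    [AddCommGroup N] [Module A N] [IsSimpleModule A N] {f : N →ₗ[A] M} (hf : f ≠ 0)
    (g : N →ₗ[A] M) : ∃ b : B, b • f = g := by
  have inj : Function.Injective f := (LinearMap.injective_or_eq_zero f).resolve_right hf
  let e := LinearEquiv.ofInjective f inj
  obtain ⟨b, hb⟩ := h (LinearMap.range f) (IsSimpleModule.congr e.symm) (g ∘ₗ e.symm)
  refine ⟨b, LinearMap.ext fun x => ?_⟩
  simpa [e] using hb (e x)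

theorem isSimpleModule_hom (h : SimpleMapsAreScalars A B M) {N : Type*}
    [AddCommGroup N] [Module A N] [IsSimpleModule A N] [Nontrivial (N →ₗ[A] M)] :
    IsSimpleModule B (N →ₗ[A] M) :=
  isSimpleModule_iff_toSpanSingleton_surjective.2
    ⟨inferInstance, fun _ hf g => exists_smul_eq_of_isSimpleModule h hf g⟩

/-- Left exactness of `Hom(-, M)`. As `M` need not be injective, the last term is only the image of
restriction to `K`. -/
theorem length_hom_eq {N : Type*} [AddCommGroup N] [Module A N] (K : Submodule A N) :
    Module.length B (N →ₗ[A] M) = Module.length B (N ⧸ K →ₗ[A] M) +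
      Module.length B (LinearMap.range (precomp (A := A) B M K.subtype)) := by
  refine Module.length_eq_add_of_exact (precomp B M K.mkQ) (precomp B M K.subtype).rangeRestrict
    (fun f g hfg => ?_) (LinearMap.surjective_rangeRestrict _) fun f => ?_
  · ext x
    exact LinearMap.congr_fun hfg x
  · constructor
    · intro hf
      have hf' : f ∘ₗ K.subtype = 0 := congrArg Subtype.val hf
      exact ⟨K.liftQ f fun x hx => LinearMap.congr_fun hf' ⟨x, hx⟩, K.liftQ_mkQ f _⟩
    · rintro ⟨g, rfl⟩
      refine Subtype.ext (LinearMap.ext fun x => ?_)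
      change g (K.mkQ x) = 0
      rw [(Submodule.Quotient.mk_eq_zero K).2 x.2 |> (show K.mkQ x = 0 from ·), map_zero]

theorem length_hom_le (h : SimpleMapsAreScalars A B M) {N : Type*} [AddCommGroup N] [Module A N] :
    Module.length B (N →ₗ[A] M) ≤ Module.length A N := by
  by_cases hN : Module.length A N = ⊤
  · simp [hN]
  replace hN := Module.length_ne_top_iff.1 hN
  induction hN with
  | of_subsingleton => simp
  | @of_simple_quotient N _ _ K _ _ ih =>
    have hs : Module.length B (N ⧸ K →ₗ[A] M) ≤ 1 := by
      rcases subsingleton_or_nontrivial (N ⧸ K →ₗ[A] M) with _ | _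
      · simp
      · have := isSimpleModule_hom h (N := N ⧸ K)
        exact (Module.length_eq_one (R := B) (M := N ⧸ K →ₗ[A] M)).le
    rw [length_hom_eq K, Module.length_eq_add_of_exact K.subtype K.mkQ K.subtype_injective
      K.mkQ_surjective (LinearMap.exact_subtype_mkQ K), Module.length_eq_one (R := A) (M := N ⧸ K),
      add_comm]
    exact add_le_add ((Module.length_le_of_injective _ (Submodule.subtype_injective _)).trans ih) hs

theorem length_le_length (h : SimpleMapsAreScalars A B M) (e : A ≃ₗ[A] M) :
    Module.length B M ≤ Module.length A M := by
  rw [e.symm.length_eq, ← (LinearMap.ringLmapEquivSelf A B M).length_eq]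
  exact length_hom_le h

/-- Both `Hom(A ⧸ I, M)` and `Hom(I, M)` obey the length bound, and the total is already attained,
so the maps that extend leave no room for others. -/
theorem baer_of_length_eq (h : SimpleMapsAreScalars A B M) (e : A ≃ₗ[A] M)
    (hAB : Module.length B M = Module.length A M) (hfin : Module.length A M ≠ ⊤) :
    Module.Baer A M := by
  intro I g
  have h₁ := length_hom_eq (B := B) (M := M) I
  rw [(LinearMap.ringLmapEquivSelf A B M).length_eq, hAB] at h₁
  have h₂ := Module.length_eq_add_of_exact I.subtype I.mkQ I.subtype_injective
      I.mkQ_surjective (LinearMap.exact_subtype_mkQ I)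
  rw [e.length_eq] at h₂
  have h₃ := length_hom_le h (N := A ⧸ I)
  have h₄ := length_hom_le h (N := I)
  have h₅ : Module.length A (A ⧸ I) ≠ ⊤ := fun h => hfin (by rw [h₂, h, add_top])
  have h₆ : Module.length A I ≠ ⊤ := fun h => hfin (by rw [h₂, h, top_add])
  have h₇ : Module.length B (I →ₗ[A] M) ≤
      Module.length B (LinearMap.range (precomp (A := A) B M I.subtype)) := by
    refine h₄.trans ((ENat.add_le_add_iff_left h₅).1 ?_)
    rw [add_comm, ← h₂, h₁]
    gcongr
  have htop : LinearMap.range (precomp (A := A) B M I.subtype) = ⊤ := by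
    by_contra hne
    have hfl := Module.length_ne_top_iff.1 (ne_top_of_le_ne_top h₆ h₄)
    have := (isFiniteLength_iff_isNoetherian_isArtinian.1 hfl).1
    have := (isFiniteLength_iff_isNoetherian_isArtinian.1 hfl).2
    exact (Submodule.length_lt hne).not_ge h₇
  obtain ⟨g', hg'⟩ := LinearMap.range_eq_top.1 htop g
  exact ⟨g', fun x mem => LinearMap.congr_fun hg' ⟨x, mem⟩⟩

/-- A nonzero element of a simple `A`-submodule of `M` generates a simple `B`-submodule. -/
theorem exists_isSimpleModule_of_mem (h : SimpleMapsAreScalars A B M) {I : Submodule A M}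
    (hI : IsSimpleModule A I) {k : M} (hk : k ∈ I) (hk0 : k ≠ 0) :
    IsSimpleModule B (Submodule.span B {k}) := by
  have hne : I.subtype ≠ 0 := fun h => hk0 (LinearMap.congr_fun h ⟨k, hk⟩)
  have : Nontrivial (I →ₗ[A] M) := ⟨⟨_, _, hne⟩⟩
  have := isSimpleModule_hom h (N := I)
  -- The span of `k` is the image of the simple module `Hom_A(I, M)` under evaluation at `k`.
  let ev : (I →ₗ[A] M) →ₗ[B] M :=
    { toFun := fun f => f ⟨k, hk⟩
      map_add' := fun _ _ => rfl
      map_smul' := fun _ _ => rfl }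
  have hev : ev ≠ 0 := fun h => hk0 (LinearMap.congr_fun h I.subtype)
  have inj : Function.Injective ev := (LinearMap.injective_or_eq_zero ev).resolve_right hev
  have hr : LinearMap.range ev = Submodule.span B {k} := by
    apply le_antisymm
    · rintro _ ⟨f, rfl⟩
      obtain ⟨b, rfl⟩ := exists_smul_eq_of_isSimpleModule h hne f
      exact Submodule.mem_span_singleton.2 ⟨b, rfl⟩
    · rw [Submodule.span_singleton_le_iff_mem]
      exact ⟨I.subtype, rfl⟩
  rw [← hr]
  exact IsSimpleModule.congr (LinearEquiv.ofInjective ev inj).symm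

end Bimodule
theorem simpleMapsAreScalars_of_isLeftMininjective {R : Type*} [Ring R]
    (h : IsLeftMininjective R) : SimpleMapsAreScalars R Rᵐᵒᵖ R := by
  intro I hI f
  obtain ⟨g, hg⟩ := h I hI f
  refine ⟨op (g 1), fun x => ?_⟩
  rw [← hg, op_smul_eq_mul, ← smul_eq_mul, ← map_smul, smul_eq_mul, mul_one]

theorem simpleMapsAreScalars_of_isRightMininjective {R : Type*} [Ring R]
    (h : IsRightMininjective R) : SimpleMapsAreScalars Rᵐᵒᵖ R R := by
  intro I hI f
  obtain ⟨g, hg⟩ := h I hI f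
  refine ⟨g 1, fun x => ?_⟩
  rw [← hg, smul_eq_mul, ← op_smul_eq_mul, ← map_smul, op_smul_eq_mul, one_mul]

/-! ### Annihilators, the radical and the artinian property -/

section

variable {R : Type*} [Ring R]

theorem ACCRightAnnihilators.exists_maximal (hacc : ACCRightAnnihilators R) {P : Set R → Prop}
    {X₀ : Set R} (h₀ : P X₀) :
    ∃ X, P X ∧ ∀ Y, P Y → rightAnnihilator X ≤ rightAnnihilator Y →
      rightAnnihilator Y ≤ rightAnnihilator X := by
  by_contra! hne
  choose! next hP hle hlt using hne
  have hPn : ∀ n, P (next^[n] X₀) := fun n => by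
    induction n with
    | zero => exact h₀
    | succ n ih => rw [Function.iterate_succ_apply']; exact hP _ ih
  obtain ⟨n, hn⟩ := hacc (fun n => next^[n] X₀) fun n => by
    rw [Function.iterate_succ_apply']; exact hle _ (hPn n)
  apply hlt _ (hPn n)
  rw [← hn (n + 1) n.le_succ, Function.iterate_succ_apply']

/-- The chain condition on right annihilators is the descending chain condition on left
annihilators, so a left annihilator is the left annihilator of a finite set. -/
theorem ACCRightAnnihilators.exists_finset (hacc : ACCRightAnnihilators R) (T : Set R) :
    ∃ F : Finset R, ↑F ⊆ T ∧ ∀ x, (∀ f ∈ F, x * f = 0) → ∀ t ∈ T, x * t = 0 := by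
  classical
  obtain ⟨_, ⟨F, hF, rfl⟩, hmax⟩ := hacc.exists_maximal
    (P := fun X => ∃ F : Finset R, ↑F ⊆ T ∧ X = {x | ∀ f ∈ F, x * f = 0})
    ⟨∅, by simp, rfl⟩
  refine ⟨F, hF, fun x hx t ht => ?_⟩
  -- Adjoining `t` to `F` enlarges the right annihilator of the left annihilator of `F`; by
  -- maximality `t` already lies in it.
  refine hmax _ ⟨insert t F, by simp [Set.insert_subset_iff, ht, hF], rfl⟩ ?_ ?_ x hx
  · exact fun r hr y hy => hr y fun f hf => hy f (Finset.mem_insert_of_mem hf)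
  · exact fun y hy => hy t (Finset.mem_insert_self _ _)

/-- The elements of the minimal right ideals of `R`. -/
def minimalElements (R : Type*) [Ring R] : Set R :=
  {k | ∃ I : Submodule Rᵐᵒᵖ R, IsSimpleModule Rᵐᵒᵖ I ∧ k ∈ I}

/-- The left annihilator of a subset of `R`, as a left ideal. -/
def leftAnnihilator (X : Set R) : Ideal R where
  carrier := {r | ∀ x ∈ X, r * x = 0}
  zero_mem' := fun x _ => zero_mul x
  add_mem' := fun {a b} ha hb x hx => by rw [add_mul, ha x hx, hb x hx, add_zero]
  smul_mem' := fun c r hr x hx => by rw [smul_eq_mul, mul_assoc, hr x hx, mul_zero]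

theorem rightSocle_le_rightAnnihilator {z : R} (hz : z ∈ leftAnnihilator (minimalElements R)) :
    rightSocle R ≤ rightAnnihilator {z} := by
  refine sSup_le fun I hI k hk x hx => ?_
  rw [Set.mem_singleton_iff.1 hx]
  exact hz k ⟨I, hI, hk⟩

theorem pow_succ_le_pow (I : Ideal R) (n : ℕ) : I ^ (n + 1) ≤ I ^ n := by
  -- For a left ideal, `I * I ^ 0` is `I * R`, which may exceed `I`, so exponent 0 is separate.
  rcases eq_or_ne n 0 with rfl | hn
  · rw [Submodule.pow_zero, Ideal.one_eq_top]
    exact le_top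
  · rw [Submodule.pow_succ' I hn]
    exact Submodule.smul_le_right

/-- The left annihilator of an essential right socle is the right singular ideal; the chain
condition on right annihilators makes it nilpotent. -/
theorem isNilpotent_leftAnnihilator (hacc : ACCRightAnnihilators R)
    (hsoc : IsEssential (rightSocle R)) :
    IsNilpotent (leftAnnihilator (minimalElements R)) := by
  set Z := leftAnnihilator (minimalElements R)
  obtain ⟨n, hn⟩ := hacc (fun n => ((Z ^ n : Ideal R) : Set R))
    fun n r hr x hx => hr x (pow_succ_le_pow Z n hx)
  refine ⟨n, ?_⟩
  by_contra hne
  obtain ⟨y, hy, hy0⟩ := (Submodule.ne_bot_iff _).1 hne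
  obtain ⟨_, ⟨a, ⟨y, hy, hya⟩, rfl⟩, hmax⟩ := hacc.exists_maximal
    (P := fun X => ∃ a : R, (∃ y ∈ Z ^ n, y * a ≠ 0) ∧ X = {a})
    ⟨1, ⟨y, hy, by rwa [mul_one]⟩, rfl⟩
  -- If `Z ^ n` did not kill `z * a`, maximality would make `a` and `z * a` have the same right
  -- annihilator. But `aR` contains some `a * b ≠ 0` in the socle, which `z` kills.
  have hZ : ∀ z ∈ Z, ∀ y ∈ Z ^ n, y * (z * a) = 0 := by
    intro z hz y hy
    by_contra hne
    have ha : Submodule.span Rᵐᵒᵖ {a} ≠ ⊥ := by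
      rw [Ne, Submodule.span_singleton_eq_bot]
      rintro rfl
      simp at hya
    obtain ⟨w, ⟨hw₁, hw₂⟩, hw0⟩ := (Submodule.ne_bot_iff _).1 (hsoc _ ha)
    obtain ⟨b, rfl⟩ := Submodule.mem_span_singleton.1 hw₂
    have hzb := rightSocle_le_rightAnnihilator hz hw₁ z rfl
    rw [← op_unop b, op_smul_eq_mul] at hw0 hzb
    refine hw0 (hmax _ ⟨z * a, ⟨y, hy, hne⟩, rfl⟩ ?_ (x := unop b) ?_ a rfl)
    · rintro r hr _ rfl
      rw [mul_assoc, hr a rfl, mul_zero]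
    · rintro _ rfl
      rw [mul_assoc, hzb]
  have hmem : a ∈ rightAnnihilator ((Z ^ (n + 1) : Ideal R) : Set R) := by
    intro x hx
    rw [SetLike.mem_coe, Submodule.pow_succ] at hx
    refine Submodule.smul_induction_on hx (fun y hy z hz => ?_) fun u v hu hv => ?_
    · rw [smul_eq_mul, mul_assoc, hZ z hz y hy]
    · rw [add_mul, hu, hv, add_zero]
  rw [hn _ n.le_succ] at hmem
  exact hya (hmem y hy)

theorem le_jacobson_of_isNilpotent {I : Ideal R} (h : IsNilpotent I) : I ≤ Ring.jacobson R := by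
  rw [← Ideal.jacobson_bot]
  intro x hx
  rw [Ideal.mem_jacobson_iff]
  intro y
  have hnil : IsNilpotent (y * x) := by
    obtain ⟨n, hn⟩ := h
    refine ⟨n, ?_⟩
    have : (y * x) ^ n ∈ I ^ n := by
      clear hn
      induction n with
      | zero => simp [Submodule.pow_zero]
      | succ n ih =>
        rw [pow_succ, Submodule.pow_succ]
        exact Submodule.smul_mem_smul ih (I.mul_mem_left y hx)
    simpa [hn] using this
  obtain ⟨u, hu⟩ := hnil.isUnit_one_add
  refine ⟨↑u⁻¹, ?_⟩
  rw [Submodule.mem_bot, mul_assoc, ← mul_add_one, add_comm, ← hu]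
  simp

theorem isSimpleModule_span_of_mem_minimalElements (h : SimpleMapsAreScalars Rᵐᵒᵖ R R) {k : R}
    (hk : k ∈ minimalElements R) (hk0 : k ≠ 0) : IsSimpleModule R (Submodule.span R {k}) := by
  obtain ⟨I, hI, hkI⟩ := hk
  exact exists_isSimpleModule_of_mem h hI hkI hk0

theorem isSemisimpleModule_span_of_mem_minimalElements (h : SimpleMapsAreScalars Rᵐᵒᵖ R R) {k : R}
    (hk : k ∈ minimalElements R) : IsSemisimpleModule R (Submodule.span R {k}) := by
  by_cases hk0 : k = 0
  · subst hk0
    have : Subsingleton (Submodule.span R {(0 : R)}) := by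
      rw [Submodule.span_zero_singleton]
      infer_instance
    exact { exists_isCompl := fun p => ⟨p, by
      simp [isCompl_iff, Submodule.eq_bot_of_subsingleton]⟩ }
  · have := isSimpleModule_span_of_mem_minimalElements h hk hk0
    infer_instance

theorem jacobson_le_leftAnnihilator (h : SimpleMapsAreScalars Rᵐᵒᵖ R R) :
    Ring.jacobson R ≤ leftAnnihilator (minimalElements R) := by
  intro j hj k hk
  have := isSemisimpleModule_span_of_mem_minimalElements h hk
  exact congrArg Subtype.val (Module.mem_annihilator.1
    (IsSemisimpleModule.jacobson_le_annihilator R (Submodule.span R {k}) hj)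
    ⟨k, Submodule.mem_span_singleton_self k⟩)

/-- Finitely many elements of minimal right ideals have the same left annihilator as all of them, so
the quotient embeds in a finite product of left modules that are simple or zero. -/
theorem isSemisimpleModule_quotient_leftAnnihilator (h : SimpleMapsAreScalars Rᵐᵒᵖ R R)
    (hacc : ACCRightAnnihilators R) :
    IsSemisimpleModule R (R ⧸ leftAnnihilator (minimalElements R)) := by
  obtain ⟨F, hF, hF'⟩ := hacc.exists_finset (minimalElements R)
  have : ∀ f : F, IsSemisimpleModule R (Submodule.span R {(f : R)}) :=
    fun f => isSemisimpleModule_span_of_mem_minimalElements h (hF f.2)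
  let φ : R →ₗ[R] (f : F) → Submodule.span R {(f : R)} := LinearMap.pi fun f =>
    LinearMap.toSpanSingleton R _ ⟨(f : R), Submodule.mem_span_singleton_self _⟩
  have hker : LinearMap.ker φ = leftAnnihilator (minimalElements R) := by
    ext x
    refine ⟨fun hx => hF' x fun f hf => ?_, fun hx => ?_⟩
    · exact congrArg Subtype.val (congrFun (LinearMap.mem_ker.1 hx) ⟨f, hf⟩)
    · exact LinearMap.mem_ker.2 (funext fun f => Subtype.ext (hx f (hF f.2)))
  rw [← hker]
  exact IsSemisimpleModule.congr φ.quotKerEquivRange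

theorem jacobson_eq_leftAnnihilator (h : SimpleMapsAreScalars Rᵐᵒᵖ R R)
    (hacc : ACCRightAnnihilators R) (hsoc : IsEssential (rightSocle R)) :
    Ring.jacobson R = leftAnnihilator (minimalElements R) :=
  (jacobson_le_leftAnnihilator h).antisymm
    (le_jacobson_of_isNilpotent (isNilpotent_leftAnnihilator hacc hsoc))

theorem isSemiprimaryRing (h : SimpleMapsAreScalars Rᵐᵒᵖ R R)
    (hacc : ACCRightAnnihilators R) (hsoc : IsEssential (rightSocle R)) :
    IsSemiprimaryRing R where
  isSemisimpleRing := by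
    have hss : IsSemisimpleModule R (R ⧸ Ring.jacobson R) := by
      rw [jacobson_eq_leftAnnihilator h hacc hsoc]
      exact isSemisimpleModule_quotient_leftAnnihilator h hacc
    -- The identity map transports semisimplicity from `R` to the quotient ring.
    let e : (R ⧸ Ring.jacobson R) →ₛₗ[Ideal.Quotient.mk (Ring.jacobson R)]
        (R ⧸ Ring.jacobson R) :=
      { AddMonoidHom.id _ with
        map_smul' := fun r x => by
          obtain ⟨y, rfl⟩ := Ideal.Quotient.mk_surjective x
          rfl }
    have : RingHomSurjective (Ideal.Quotient.mk (Ring.jacobson R)) :=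
      ⟨Ideal.Quotient.mk_surjective⟩
    exact (e.isSemisimpleModule_iff_of_bijective Function.bijective_id).1 hss
  isNilpotent := by
    rw [jacobson_eq_leftAnnihilator h hacc hsoc]
    exact isNilpotent_leftAnnihilator hacc hsoc

/-- The left annihilator of a two-sided ideal with semisimple quotient embeds into the dual of the
right module `R ⧸ J`. -/
theorem isArtinian_leftAnnihilator_of_isSemisimpleRing (h : SimpleMapsAreScalars Rᵐᵒᵖ R R)
    (J : Ideal R) [J.IsTwoSided] [IsSemisimpleRing (R ⧸ J)] :
    IsArtinian R (leftAnnihilator (J : Set R)) := by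
  let σ : Rᵐᵒᵖ →+* (R ⧸ J)ᵐᵒᵖ := (Ideal.Quotient.mk J).op
  have hσ : RingHomSurjective σ := ⟨fun x => by
    obtain ⟨y, hy⟩ := Ideal.Quotient.mk_surjective (unop x)
    exact ⟨op y, unop_injective hy⟩⟩
  let : Module Rᵐᵒᵖ (R ⧸ J)ᵐᵒᵖ := Module.compHom _ σ
  let e : (R ⧸ J)ᵐᵒᵖ →ₛₗ[σ] (R ⧸ J)ᵐᵒᵖ := { AddMonoidHom.id _ with map_smul' := fun _ _ => rfl }
  have hart : IsArtinian Rᵐᵒᵖ (R ⧸ J)ᵐᵒᵖ :=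
    (e.isArtinian_iff_of_bijective Function.bijective_id).2 inferInstance
  have hnoeth : IsNoetherian Rᵐᵒᵖ (R ⧸ J)ᵐᵒᵖ :=
    (e.isNoetherian_iff_of_bijective Function.bijective_id).2 inferInstance
  have hfin : IsFiniteLength R ((R ⧸ J)ᵐᵒᵖ →ₗ[Rᵐᵒᵖ] R) := Module.length_ne_top_iff.1
    (ne_top_of_le_ne_top Module.length_ne_top (length_hom_le h (N := (R ⧸ J)ᵐᵒᵖ)))
  have := (isFiniteLength_iff_isNoetherian_isArtinian.1 hfin).2
  let ev : ((R ⧸ J)ᵐᵒᵖ →ₗ[Rᵐᵒᵖ] R) →ₗ[R] R :=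
    { toFun := fun f => f 1
      map_add' := fun _ _ => rfl
      map_smul' := fun _ _ => rfl }
  have hle : leftAnnihilator (J : Set R) ≤ LinearMap.range ev := by
    intro x hx
    -- Left multiplication by `x` kills `J`, hence descends to `R ⧸ J`; its value at 1 is `x`.
    let f : R ⧸ J →+ R := QuotientAddGroup.lift J.toAddSubgroup (AddMonoidHom.mulLeft x) hx
    refine ⟨{ toFun := fun q => f (unop q), map_add' := fun p q => map_add f _ _,
              map_smul' := fun r q => ?_ }, ?_⟩
    · obtain ⟨y, hy⟩ := Ideal.Quotient.mk_surjective (unop q)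
      change f (unop q * Ideal.Quotient.mk J (unop r)) = f (unop q) * unop r
      rw [← hy]
      exact (mul_assoc x y (unop r)).symm
    · exact mul_one x
  exact isArtinian_of_le hle

/-- Right multiplication by a finite subset `F` of `J` with the left annihilator of `J` carries the
left annihilator of `J ^ (n + 1)` into a finite power of that of `J ^ n`, with kernel inside that of
`J`. -/
theorem isArtinian_leftAnnihilator_pow (hacc : ACCRightAnnihilators R) (J : Ideal R)
    [J.IsTwoSided] (hJ : IsArtinian R (leftAnnihilator (J : Set R))) (n : ℕ) :
    IsArtinian R (leftAnnihilator ((J ^ n : Ideal R) : Set R)) := by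
  obtain ⟨F, hF, hF'⟩ := hacc.exists_finset (J : Set R)
  induction n with
  | zero =>
    have : leftAnnihilator (((J ^ 0 : Ideal R)) : Set R) = ⊥ := by
      rw [eq_bot_iff]
      intro x hx
      simpa using hx 1 (by simp [Submodule.pow_zero])
    rw [this]
    infer_instance
  | succ n ih =>
    let φ : leftAnnihilator ((J ^ (n + 1) : Ideal R) : Set R) →ₗ[R]
        F → leftAnnihilator ((J ^ n : Ideal R) : Set R) := LinearMap.pi fun f =>
      { toFun := fun x => ⟨x * f, fun y hy => by
          rw [mul_assoc]
          refine x.2 _ ?_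
          rw [SetLike.mem_coe, Ideal.IsTwoSided.pow_succ]
          exact Submodule.smul_mem_smul (hF f.2) hy⟩
        map_add' := fun x y => Subtype.ext (add_mul (x : R) y f)
        map_smul' := fun r x => Subtype.ext (mul_assoc r (x : R) f) }
    have hker : IsArtinian R (LinearMap.ker φ) := by
      let ψ : LinearMap.ker φ →ₗ[R] leftAnnihilator (J : Set R) :=
        { toFun := fun x => ⟨x, hF' _ fun f hf =>
            congrArg Subtype.val (congrFun (LinearMap.mem_ker.1 x.2) ⟨f, hf⟩)⟩
          map_add' := fun _ _ => rfl
          map_smul' := fun _ _ => rfl }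
      refine isArtinian_of_injective ψ fun x y hxy => ?_
      exact Subtype.ext (Subtype.ext (congrArg (fun z : leftAnnihilator (J : Set R) => (z : R)) hxy))
    exact isArtinian_of_range_eq_ker (LinearMap.ker φ).subtype φ (by simp)

theorem isArtinian_of_isRightMininjective (h : SimpleMapsAreScalars Rᵐᵒᵖ R R)
    (hacc : ACCRightAnnihilators R) (hsoc : IsEssential (rightSocle R)) : IsArtinian R R := by
  have := isSemiprimaryRing h hacc hsoc
  obtain ⟨n, hn⟩ := IsSemiprimaryRing.isNilpotent (R := R)
  have hart := isArtinian_leftAnnihilator_pow hacc (Ring.jacobson R)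
    (isArtinian_leftAnnihilator_of_isSemisimpleRing h _) n
  have htop : leftAnnihilator ((Ring.jacobson R ^ n : Ideal R) : Set R) = ⊤ := by
    rw [hn, eq_top_iff]
    intro x _ y hy
    rw [show y = 0 from hy, mul_zero]
  rw [htop] at hart
  exact (Submodule.topEquiv.isArtinian_iff_of_bijective Submodule.topEquiv.bijective).1 hart

end

end QFRing

theorem theorem2p13 (R : Type*) [Ring R]
    (hl : QFRing.IsLeftMininjective R) (hr : QFRing.IsRightMininjective R)
    (hacc : QFRing.ACCRightAnnihilators R)
    (hsoc : QFRing.IsEssential (QFRing.rightSocle R)) :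
    QFRing.IsQuasiFrobenius R := by
  have hl' := QFRing.simpleMapsAreScalars_of_isLeftMininjective hl
  have hr' := QFRing.simpleMapsAreScalars_of_isRightMininjective hr
  let eR : Rᵐᵒᵖ ≃ₗ[Rᵐᵒᵖ] R :=
    { MulOpposite.opAddEquiv.symm with map_smul' := fun _ _ => rfl }
  have hart : IsArtinianRing R := QFRing.isArtinian_of_isRightMininjective hr' hacc hsoc
  have hlen : Module.length R R = Module.length Rᵐᵒᵖ R :=
    (QFRing.length_le_length hr' eR).antisymm (QFRing.length_le_length hl' (LinearEquiv.refl R R))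
  have hfin : Module.length R R ≠ ⊤ := Module.length_ne_top
  have hfin' : Module.length Rᵐᵒᵖ R ≠ ⊤ := hlen ▸ hfin
  exact
    { left_artinian := hart
      right_artinian :=
        (isFiniteLength_iff_isNoetherian_isArtinian.1 (Module.length_ne_top_iff.1 hfin')).2
      left_self_injective :=
        (QFRing.baer_of_length_eq hl' (LinearEquiv.refl R R) hlen.symm hfin).injective
      right_self_injective := (QFRing.baer_of_length_eq hr' eR hlen hfin').injective }
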